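/- Let $G$ be a (finite) embedded graph, i.e. a cellularly embedded graph, or equivalently a ribbon graph or an arrow presentation. Let $\alpha,\beta,\gamma$ be elements of a commutative ring $R$ with unity. The medial graph $G_m$ has one vertex $v_e$, of degree four, on each edge $e$ of $G$, and its edges follow the face boundaries of $G$; an isolated vertex of $G$ gives a free loop (a closed edge without vertices). The faces of $G_m$ correspond to the vertices and the faces of $G$; in the canonical checkerboard colouring the former are black and the latter white. A vertex state at $v_e$ is a partition into pairs of the four half-edges at $v_e$; the half-edges of each pair are joined. It is the white smoothing if the two half-edges bounding each white corner at $v_e$ are paired, the black smoothing if the two half-edges bounding each black corner are paired, and the crossing if opposite half-edges are paired. A graph state $s\in\mathcal S(G_m)$ is a choice of vertex state at every vertex; $\omega(s)$ is the product over all vertices of $\alpha$, $\beta$, $\gamma$ for a white smoothing, black smoothing, crossing respectively, and $c(s)$ is the number of closed curves of $s$ (free loops included). The topological transition polynomial is $$Q(G;(\alpha,\beta,\gamma),t)=\sum_{s\in\mathcal S(G_m)}\omega(s)\,t^{c(s)}\in R[t].$$ For $k\in\mathbb N$, a $k$-valuation of $G_m$ is a map $\phi:E(G_m)\to\{1,\dots,k\}$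 such that at every vertex each colour appears on an even number of half-edges; $\mathcal K(G_m,k)$ is the set of them. The vertex $v_e$ is of total type in $\phi$ if its four half-edges have the same colour. Otherwise exactly two colours appear at $v_e$, each on two half-edges, and $v_e$ is of white type if the half-edges bounding each white corner have equal colours, of black type if the half-edges bounding each black corner have equal colours, and of crossing type if opposite half-edges have equal colours. Let $\mathrm{total}(\phi),\mathrm{white}(\phi),\mathrm{black}(\phi),\mathrm{cross}(\phi)$ be the numbers of vertices of each type. Then, for every $k\in\mathbb N$, $$Q(G;(\alpha,\beta,\gamma),k)=\sum_{\phi\in\mathcal K(G_m,k)}(\alpha+\beta+\gamma)^{\mathrm{total}(\phi)}\,\alpha^{\mathrm{white}(\phi)}\,\beta^{\mathrm{black}(\phi)}\,\gamma^{\mathrm{cross}(\phi)}.$$ -/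

import Mathlib

/-- The marking arrows of an arrow presentation with label set `E`: each label `e` occurs on exactly
two arrows, `(e, 0)` and `(e, 1)`. -/
abbrev MarkingArrow (E : Type*) := E × Fin 2

/-- The two endpoints of a marking arrow. -/
inductive ArrowEnd
  | tail
  | tip

/-- The two colours of a checkerboard colouring. -/
inductive FaceColour
  | black
  | white

/-- An embedded graph with vertex set `V` and edge set `E`, given as an arrow presentation: a set `V`
of circles carrying disjoint labelled arrows, two for each label `e : E`. Every circle is drawn
with an auxiliary orientation. -/
structure EmbeddedGraph (V E : Type*) where
  /-- The circle on which an arrow lies. -/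
  circle : MarkingArrow E → V
  /-- The arrow that follows a given one when travelling along its (oriented) circle. -/
  next : Equiv.Perm (MarkingArrow E)
  /-- The arrows on one circle form one cyclic sequence. -/
  sameCycle_iff : ∀ a b, next.SameCycle a b ↔ circle a = circle b
  /-- Whether an arrow points in the direction of the orientation of its circle. -/
  forward : MarkingArrow E → Bool

namespace EmbeddedGraph

/-- The edges of the medial graph. They follow the face boundaries of `G` from one edge of `G` to the
next, so there is one for each arc of a vertex circle between consecutive arrows; the arc that leads
from `a` to `G.next a` is `Sum.inl a`. Every isolated vertex gives a free loop. -/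
abbrev MedialEdge {V E : Type*} (G : EmbeddedGraph V E) :=
  MarkingArrow E ⊕ {v : V // ∀ a, G.circle a ≠ v}

/-- The arc of the vertex circle, as an edge of the medial graph, that is attached to an endpoint of
an arrow. -/
def arcAt {V E : Type*} (G : EmbeddedGraph V E) (a : MarkingArrow E) : ArrowEnd → G.MedialEdge
  | .tip => Sum.inl (if G.forward a then a else G.next.symm a)
  | .tail => Sum.inl (if G.forward a then G.next.symm a else a)

/-- The vertices of the medial graph are indexed by the edges `e` of `G`. The four half-edges at the
vertex `v_e` leave through the endpoints of the two `e`-labelled arrows. They are numbered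
`0, 1, 2, 3` in their cyclic order around `v_e`, that is, in the order in which these endpoints are
met along the boundary of the edge disc of `e`, with which both arrows agree. `G.medialEnd e i` is
the edge of the medial graph that contains the `i`-th half-edge at `v_e`. -/
def medialEnd {V E : Type*} (G : EmbeddedGraph V E) (e : E) : Fin 4 → G.MedialEdge :=
  ![G.arcAt (e, 0) .tail, G.arcAt (e, 0) .tip, G.arcAt (e, 1) .tail, G.arcAt (e, 1) .tip]

/-- Two arcs of vertex circles are joined by a side of an edge disc. -/
def SideRel {V E : Type*} (G : EmbeddedGraph V E) (x y : G.MedialEdge) : Prop :=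
  ∃ e : E, (x = G.arcAt (e, 0) .tip ∧ y = G.arcAt (e, 1) .tail) ∨
    (x = G.arcAt (e, 1) .tip ∧ y = G.arcAt (e, 0) .tail)

/-- The faces of `G`, i.e. the boundary components of the ribbon graph: each is made of arcs of vertex
circles joined by sides of edge discs. -/
def Face {V E : Type*} (G : EmbeddedGraph V E) := Quot G.SideRel

/-- The faces of the medial graph: one for each vertex and one for each face of `G`. -/
abbrev MedialFace {V E : Type*} (G : EmbeddedGraph V E) := V ⊕ G.Face

/-- The canonical checkerboard colouring of the medial graph. -/
def canonicalColour {V E : Type*} (G : EmbeddedGraph V E) : G.MedialFace → FaceColour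
  | Sum.inl _ => .black
  | Sum.inr _ => .white

/-- The face of the medial graph that contains the corner at `v_e` between the half-edges `i` and
`i + 1` (mod 4). -/
def cornerFace {V E : Type*} (G : EmbeddedGraph V E) (e : E) : Fin 4 → G.MedialFace :=
  ![Sum.inl (G.circle (e, 0)), Sum.inr (Quot.mk _ (G.arcAt (e, 0) .tip)),
    Sum.inl (G.circle (e, 1)), Sum.inr (Quot.mk _ (G.arcAt (e, 1) .tip))]

/-- The colour of the corner at `v_e` between the half-edges `i` and `i + 1` (mod 4). -/
def cornerColour {V E : Type*} (G : EmbeddedGraph V E) (e : E) (i : Fin 4) : FaceColour :=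
  G.canonicalColour (G.cornerFace e i)

/-- A vertex state: a partition into pairs of the four half-edges at a vertex, given as the
fixed-point-free involution that exchanges the members of each pair. -/
abbrev VertexState := {p : Equiv.Perm (Fin 4) // ∀ i, p i ≠ i ∧ p (p i) = i}

/-- The smoothing of colour `c` at `v_e`: it joins the two half-edges on either side of each corner of
colour `c`. -/
def IsSmoothing {V E : Type*} (G : EmbeddedGraph V E) (c : FaceColour) (e : E)
    (p : VertexState) : Prop :=
  ∀ i : Fin 4, G.cornerColour e i = c → p.1 i = i + 1

/-- The crossing: it joins opposite half-edges. -/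
def IsCrossing (p : VertexState) : Prop := ∀ i : Fin 4, p.1 i = i + 2

/-- Every vertex state is a white smoothing, a black smoothing or a crossing. -/
theorem vertexState_cases {V E : Type*} (G : EmbeddedGraph V E) (e : E) (p : VertexState) :
    G.IsSmoothing .white e p ∨ G.IsSmoothing .black e p ∨ IsCrossing p := by
  have h : (p.1 1 = 2 ∧ p.1 3 = 0) ∨ (p.1 0 = 1 ∧ p.1 2 = 3) ∨ IsCrossing p := by
    unfold IsCrossing
    revert p
    decide
  refine h.imp (fun hw i hi => ?_) (Or.imp_left fun hb i hi => ?_)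
  · fin_cases i
    · cases hi
    · exact hw.1
    · cases hi
    · exact hw.2
  · fin_cases i
    · exact hb.1
    · cases hi
    · exact hb.2
    · cases hi

/-- The weight of a vertex state in the medial weight system `(α, β, γ)`: `α` for a white smoothing,
`β` for a black smoothing, and `γ` for a crossing, the only remaining case. -/
noncomputable def vertexWeight {V E R : Type*} (G : EmbeddedGraph V E) (α β γ : R) (e : E)
    (p : VertexState) : R :=
  open Classical in
  if G.IsSmoothing .white e p then α else if G.IsSmoothing .black e p then β else γ

/-- A graph state of the medial graph: a choice of vertex state at each vertex. -/
abbrev GraphState {V E : Type*} (_G : EmbeddedGraph V E) := E → VertexState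

/-- Two edges of the medial graph have ends that are joined to each other at a vertex in the graph
state `s`. -/
def Joined {V E : Type*} (G : EmbeddedGraph V E) (s : G.GraphState) (x y : G.MedialEdge) : Prop :=
  ∃ (e : E) (i : Fin 4), x = G.medialEnd e i ∧ y = G.medialEnd e ((s e).1 i)

/-- The number `c(s)` of closed curves of the graph state `s`, each of which is made of medial edges
joined to one another (or is a single free loop). -/
noncomputable def stateComponents {V E : Type*} (G : EmbeddedGraph V E) (s : G.GraphState) : ℕ :=
  Nat.card (Quot (G.Joined s))

/-- The topological transition polynomial `Q(G; (α, β, γ), t)`, a polynomial in `t`. -/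
noncomputable def transitionPolynomial {V E R : Type*} [Fintype E] [CommRing R]
    (G : EmbeddedGraph V E) (α β γ : R) : Polynomial R :=
  open Classical in
  ∑ s : G.GraphState, Polynomial.C (∏ e : E, G.vertexWeight α β γ e (s e)) *
    Polynomial.X ^ G.stateComponents s

/-- The `k`-valuations of the medial graph: edge `k`-colourings in which every colour appears on an
even number of half-edges at every vertex (an edge with both ends at the vertex counts twice). -/
abbrev KValuation {V E : Type*} (G : EmbeddedGraph V E) (k : ℕ) :=
  {φ : G.MedialEdge → Fin k //
    ∀ (e : E) (c : Fin k), Even (Nat.card {i : Fin 4 // φ (G.medialEnd e i) = c})}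

noncomputable instance {V E : Type*} [Finite V] [Finite E] (G : EmbeddedGraph V E) (k : ℕ) :
    Fintype (G.KValuation k) := Fintype.ofFinite _

/-- All four half-edges at `v_e` have the same colour. -/
def IsTotalAt {V E : Type*} (G : EmbeddedGraph V E) {k : ℕ} (φ : G.KValuation k) (e : E) : Prop :=
  ∀ i j : Fin 4, φ.1 (G.medialEnd e i) = φ.1 (G.medialEnd e j)

/-- Two distinct colours appear at `v_e`, and the two half-edges on either side of each corner of
colour `c` have the same colour (the white type for `c = .white`, the black type for `c = .black`). -/
def IsSmoothAt {V E : Type*} (G : EmbeddedGraph V E) (c : FaceColour) {k : ℕ}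
    (φ : G.KValuation k) (e : E) : Prop :=
  ¬ G.IsTotalAt φ e ∧ ∀ i : Fin 4, G.cornerColour e i = c →
    φ.1 (G.medialEnd e i) = φ.1 (G.medialEnd e (i + 1))

/-- Two distinct colours appear at `v_e`, and opposite half-edges have the same colour. -/
def IsCrossAt {V E : Type*} (G : EmbeddedGraph V E) {k : ℕ} (φ : G.KValuation k) (e : E) : Prop :=
  ¬ G.IsTotalAt φ e ∧ ∀ i : Fin 4,
    φ.1 (G.medialEnd e i) = φ.1 (G.medialEnd e (i + 2))

/-- The number of vertices of total type. -/
noncomputable def total {V E : Type*} (G : EmbeddedGraph V E) {k : ℕ} (φ : G.KValuation k) : ℕ :=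
  Nat.card {e : E // G.IsTotalAt φ e}

/-- The number of vertices of white type. -/
noncomputable def white {V E : Type*} (G : EmbeddedGraph V E) {k : ℕ} (φ : G.KValuation k) : ℕ :=
  Nat.card {e : E // G.IsSmoothAt .white φ e}

/-- The number of vertices of black type. -/
noncomputable def black {V E : Type*} (G : EmbeddedGraph V E) {k : ℕ} (φ : G.KValuation k) : ℕ :=
  Nat.card {e : E // G.IsSmoothAt .black φ e}

/-- The number of vertices of crossing type. -/
noncomputable def cross {V E : Type*} (G : EmbeddedGraph V E) {k : ℕ} (φ : G.KValuation k) : ℕ :=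
  Nat.card {e : E // G.IsCrossAt φ e}

end EmbeddedGraph

namespace EmbeddedGraph

/-! The number `k ^ c(s)` counts the colourings of the medial edges with `k` colours that are
constant on each closed curve of `s`, that is, in which every pair of half-edges joined by `s` has
equal colours (`card_pow_stateComponents`). Exchange the two sums: for a fixed colouring,
compatibility with `s` is tested vertex by vertex, so the weighted sum over compatible states
factors into local sums over the three pairings at each vertex
(`eval_transitionPolynomial_eq_sum_colourings`).

The local sums are finite combinatorics of four coloured points. If some colour occurs an odd number
of times, no pairing is compatible and the whole product vanishes, so only `k`-valuations survive
(`even_fibres_iff`). If two colours occur twice each, exactly one pairing is compatible, the one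
that names the type; if all four colours agree, all three are, and they contribute `α + β + γ`
(`sum_compatible_vertexWeight_kValuation`). -/

/-- The pairing of the half-edges around the corners `1`–`2` and `3`–`0`. -/
def whiteState : VertexState :=
  ⟨Equiv.swap 1 2 * Equiv.swap 3 0, by decide⟩

/-- The pairing of the half-edges around the corners `0`–`1` and `2`–`3`. -/
def blackState : VertexState :=
  ⟨Equiv.swap 0 1 * Equiv.swap 2 3, by decide⟩

/-- The pairing of opposite half-edges. -/
def crossState : VertexState :=
  ⟨Equiv.swap 0 2 * Equiv.swap 1 3, by decide⟩

theorem univ_vertexState :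
    (Finset.univ : Finset VertexState) = {whiteState, blackState, crossState} := by
  decide

/-- Around `v_e` the corners lie alternately in vertex faces (0 and 2, black) and in faces of `G` (1
and 3, white). -/
theorem forall_cornerColour_white {V E : Type*} (G : EmbeddedGraph V E) (e : E)
    (P : Fin 4 → Prop) : (∀ i, G.cornerColour e i = .white → P i) ↔ P 1 ∧ P 3 := by
  simp [Fin.forall_fin_succ, cornerColour, cornerFace, canonicalColour]

theorem forall_cornerColour_black {V E : Type*} (G : EmbeddedGraph V E) (e : E)
    (P : Fin 4 → Prop) : (∀ i, G.cornerColour e i = .black → P i) ↔ P 0 ∧ P 2 := by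
  simp [Fin.forall_fin_succ, cornerColour, cornerFace, canonicalColour]

section LocalWeights

variable {V E R : Type*} (G : EmbeddedGraph V E) (α β γ : R) (e : E)

theorem vertexWeight_whiteState : G.vertexWeight α β γ e whiteState = α := by
  rw [vertexWeight, if_pos]
  rw [IsSmoothing, forall_cornerColour_white]
  decide

theorem vertexWeight_blackState : G.vertexWeight α β γ e blackState = β := by
  rw [vertexWeight, if_neg, if_pos]
  · rw [IsSmoothing, forall_cornerColour_black]
    decide
  · rw [IsSmoothing, forall_cornerColour_white]
    decide

theorem vertexWeight_crossState : G.vertexWeight α β γ e crossState = γ := by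
  rw [vertexWeight, if_neg, if_neg]
  · rw [IsSmoothing, forall_cornerColour_black]
    decide
  · rw [IsSmoothing, forall_cornerColour_white]
    decide

end LocalWeights

section Compatibility

variable {C : Type*} (g : Fin 4 → C)

theorem forall_eq_whiteState :
    (∀ i, g i = g (whiteState.1 i)) ↔ g 1 = g 2 ∧ g 3 = g 0 := by
  have h0 : whiteState.1 0 = 3 := by decide
  have h1 : whiteState.1 1 = 2 := by decide
  have h2 : whiteState.1 2 = 1 := by decide
  have h3 : whiteState.1 3 = 0 := by decide
  rw [Fin.forall_fin_succ, Fin.forall_fin_succ, Fin.forall_fin_succ, Fin.forall_fin_one]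
  change g 0 = g (whiteState.1 0) ∧ g 1 = g (whiteState.1 1) ∧ g 2 = g (whiteState.1 2) ∧
    g 3 = g (whiteState.1 3) ↔ _
  rw [h0, h1, h2, h3]
  grind

theorem forall_eq_blackState :
    (∀ i, g i = g (blackState.1 i)) ↔ g 0 = g 1 ∧ g 2 = g 3 := by
  have h0 : blackState.1 0 = 1 := by decide
  have h1 : blackState.1 1 = 0 := by decide
  have h2 : blackState.1 2 = 3 := by decide
  have h3 : blackState.1 3 = 2 := by decide
  rw [Fin.forall_fin_succ, Fin.forall_fin_succ, Fin.forall_fin_succ, Fin.forall_fin_one]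
  change g 0 = g (blackState.1 0) ∧ g 1 = g (blackState.1 1) ∧ g 2 = g (blackState.1 2) ∧
    g 3 = g (blackState.1 3) ↔ _
  rw [h0, h1, h2, h3]
  grind

theorem forall_eq_crossState :
    (∀ i, g i = g (crossState.1 i)) ↔ g 0 = g 2 ∧ g 1 = g 3 := by
  have h0 : crossState.1 0 = 2 := by decide
  have h1 : crossState.1 1 = 3 := by decide
  have h2 : crossState.1 2 = 0 := by decide
  have h3 : crossState.1 3 = 1 := by decide
  rw [Fin.forall_fin_succ, Fin.forall_fin_succ, Fin.forall_fin_succ, Fin.forall_fin_one]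
  change g 0 = g (crossState.1 0) ∧ g 1 = g (crossState.1 1) ∧ g 2 = g (crossState.1 2) ∧
    g 3 = g (crossState.1 3) ↔ _
  rw [h0, h1, h2, h3]
  grind

/-- Even fibres on four points have sizes 2 + 2 or 4, so they can be split into pairs, and there are
only three pairings. Conversely, each fibre is a union of pairs of a compatible pairing. -/
theorem even_fibres_iff :
    (∀ c, Even (Nat.card {i : Fin 4 // g i = c})) ↔
      (g 1 = g 2 ∧ g 3 = g 0) ∨ (g 0 = g 1 ∧ g 2 = g 3) ∨ (g 0 = g 2 ∧ g 1 = g 3) := by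
  classical
  have hcard (c : C) : Nat.card {i : Fin 4 // g i = c} =
      (if g 0 = c then 1 else 0) + (if g 1 = c then 1 else 0) +
        (if g 2 = c then 1 else 0) + (if g 3 = c then 1 else 0) := by
    rw [Nat.card_eq_fintype_card, Fintype.card_subtype, Finset.card_filter, Fin.sum_univ_four]
  simp only [hcard]
  constructor
  · intro h
    -- Only colours that occur need testing: every other fibre is empty.
    have h0 := h (g 0)
    have h1 := h (g 1)
    have h2 := h (g 2)
    have h3 := h (g 3)
    grind
  · intro h c
    grind

theorem forall_forall_fin_four_eq :
    (∀ i j, g i = g j) ↔ g 0 = g 1 ∧ g 1 = g 2 ∧ g 2 = g 3 := by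
  refine ⟨fun h => ⟨h _ _, h _ _, h _ _⟩, fun h => ?_⟩
  have hi (i : Fin 4) : g i = g 0 := by
    fin_cases i
    · rfl
    · exact h.1.symm
    · exact (h.1.trans h.2.1).symm
    · exact (h.1.trans (h.2.1.trans h.2.2)).symm
  exact fun i j => (hi i).trans (hi j).symm

end Compatibility

/-- The total weight of the vertex states at `e` that pair half-edges of equal colour. -/
theorem sum_compatible_vertexWeight {V E R C : Type*} [CommRing R] [DecidableEq C]
    (G : EmbeddedGraph V E) (α β γ : R) (e : E) (g : Fin 4 → C) :
    (∑ p : VertexState, if ∀ i, g i = g (p.1 i) then G.vertexWeight α β γ e p else 0) =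
      (if g 1 = g 2 ∧ g 3 = g 0 then α else 0) + (if g 0 = g 1 ∧ g 2 = g 3 then β else 0) +
        (if g 0 = g 2 ∧ g 1 = g 3 then γ else 0) := by
  rw [univ_vertexState, Finset.sum_insert (by decide), Finset.sum_insert (by decide),
    Finset.sum_singleton]
  simp only [forall_eq_whiteState, forall_eq_blackState, forall_eq_crossState,
    vertexWeight_whiteState, vertexWeight_blackState, vertexWeight_crossState, add_assoc]

open Classical in
/-- At a vertex of a `k`-valuation, the compatible vertex states contribute the factor of the type of
the vertex. -/
theorem sum_compatible_vertexWeight_kValuation {V E R : Type*} [CommRing R]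
    (G : EmbeddedGraph V E) (α β γ : R) {k : ℕ} (φ : G.KValuation k) (e : E) :
    (∑ p : VertexState, if ∀ i, φ.1 (G.medialEnd e i) = φ.1 (G.medialEnd e (p.1 i))
        then G.vertexWeight α β γ e p else 0) =
      (if G.IsTotalAt φ e then α + β + γ else 1) * (if G.IsSmoothAt .white φ e then α else 1) *
        (if G.IsSmoothAt .black φ e then β else 1) * (if G.IsCrossAt φ e then γ else 1) := by
  have hev := (even_fibres_iff fun i => φ.1 (G.medialEnd e i)).1 (φ.2 e)
  have htotal : G.IsTotalAt φ e ↔ _ :=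
    forall_forall_fin_four_eq fun i => φ.1 (G.medialEnd e i)
  have hwhite : G.IsSmoothAt .white φ e ↔ ¬ G.IsTotalAt φ e ∧
      φ.1 (G.medialEnd e 1) = φ.1 (G.medialEnd e 2) ∧
      φ.1 (G.medialEnd e 3) = φ.1 (G.medialEnd e 0) :=
    and_congr_right' (G.forall_cornerColour_white e _)
  have hblack : G.IsSmoothAt .black φ e ↔ ¬ G.IsTotalAt φ e ∧
      φ.1 (G.medialEnd e 0) = φ.1 (G.medialEnd e 1) ∧
      φ.1 (G.medialEnd e 2) = φ.1 (G.medialEnd e 3) :=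
    and_congr_right' (G.forall_cornerColour_black e _)
  have hcross : G.IsCrossAt φ e ↔ ¬ G.IsTotalAt φ e ∧
      φ.1 (G.medialEnd e 0) = φ.1 (G.medialEnd e 2) ∧
      φ.1 (G.medialEnd e 1) = φ.1 (G.medialEnd e 3) := by
    refine and_congr_right' ⟨fun h => ⟨h 0, h 1⟩, fun h i => ?_⟩
    fin_cases i
    · exact h.1
    · exact h.2
    · exact h.1.symm
    · exact h.2.symm
  rw [sum_compatible_vertexWeight G α β γ e fun i => φ.1 (G.medialEnd e i)]
  generalize φ.1 (G.medialEnd e 0) = a at *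
  generalize φ.1 (G.medialEnd e 1) = b at *
  generalize φ.1 (G.medialEnd e 2) = c at *
  generalize φ.1 (G.medialEnd e 3) = d at *
  simp only [hwhite, hblack, hcross, htotal]
  -- Evenness (`hev`) provides a compatible pairing, and two different ones together force all four
  -- colours to agree. Hence either exactly one term survives or all three do.
  by_cases hab : a = b <;> by_cases hbc : b = c <;> by_cases hcd : c = d <;>
    by_cases hda : d = a <;> by_cases hac : a = c <;> by_cases hbd : b = d <;> grind

/-- Maps that are constant on the classes generated by a relation are the maps out of the quotient. -/
def quotArrowEquiv {A B : Type*} (r : A → A → Prop) :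
    (Quot r → B) ≃ {f : A → B // ∀ x y, r x y → f x = f y} where
  toFun h := ⟨fun a => h (Quot.mk r a), fun _ _ hxy => congrArg h (Quot.sound hxy)⟩
  invFun f := Quot.lift f.1 f.2
  left_inv h := by
    funext q
    induction q using Quot.ind
    rfl
  right_inv _ := rfl

open Classical in
/-- The number of edge `k`-colourings constant on the closed curves of a graph state. -/
theorem card_pow_stateComponents {V E : Type*} [Fintype V] [Fintype E] (G : EmbeddedGraph V E)
    (s : G.GraphState) (k : ℕ) :
    k ^ G.stateComponents s =
      ({f : G.MedialEdge → Fin k | ∀ e i, f (G.medialEnd e i) = f (G.medialEnd e ((s e).1 i))} :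
        Finset (G.MedialEdge → Fin k)).card := by
  have hjoined (f : G.MedialEdge → Fin k) : (∀ x y, G.Joined s x y → f x = f y) ↔
      ∀ e i, f (G.medialEnd e i) = f (G.medialEnd e ((s e).1 i)) := by
    constructor
    · exact fun h e i => h _ _ ⟨e, i, rfl, rfl⟩
    · rintro h x y ⟨e, i, rfl, rfl⟩
      exact h e i
  rw [stateComponents, ← Fintype.card_subtype, ← Nat.card_eq_fintype_card,
    ← Nat.card_congr (Equiv.subtypeEquivRight hjoined),
    ← Nat.card_congr (quotArrowEquiv (G.Joined s)), Nat.card_fun, Nat.card_fin]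

/-- Turns the global type counts into products over the vertices, to be matched with the local sums
factor by factor. -/
theorem pow_card_subtype {E R : Type*} [Fintype E] [CommRing R] (P : E → Prop) [DecidablePred P]
    (a : R) : a ^ Nat.card {e // P e} = ∏ e : E, if P e then a else 1 := by
  rw [Finset.prod_ite, Finset.prod_const, Finset.prod_const_one, mul_one,
    Nat.card_eq_fintype_card, Fintype.card_subtype]

open Classical in
/-- The transition polynomial at `k` is a sum over all edge `k`-colourings of the medial graph. -/
theorem eval_transitionPolynomial_eq_sum_colourings {V E R : Type*} [Fintype V] [Fintype E]
    [CommRing R] (G : EmbeddedGraph V E) (α β γ : R) (k : ℕ) :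
    (G.transitionPolynomial α β γ).eval (k : R) =
      ∑ f : G.MedialEdge → Fin k, ∏ e : E, ∑ p : VertexState,
        if ∀ i, f (G.medialEnd e i) = f (G.medialEnd e (p.1 i))
          then G.vertexWeight α β γ e p else 0 := by
  -- `Fintype.prod_sum` expands the product of local sums into a sum over graph states.
  simp only [transitionPolynomial, Polynomial.eval_finsetSum, Polynomial.eval_mul,
    Polynomial.eval_C, Polynomial.eval_pow, Polynomial.eval_X, Fintype.prod_sum]
  rw [Finset.sum_comm]
  refine Finset.sum_congr (by congr!) fun s _ => ?_
  rw [← Nat.cast_pow, card_pow_stateComponents, mul_comm, ← nsmul_eq_mul, ← Finset.sum_const,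
    Finset.sum_filter]
  -- A product of terms cut off at each vertex is the full weight cut off by compatibility at all
  -- vertices.
  exact Finset.sum_congr rfl fun f _ => by rw [Fintype.prod_ite_zero]

end EmbeddedGraph

theorem theorem4p2 {V E R : Type*} [Fintype V] [Fintype E] [CommRing R]
    (G : EmbeddedGraph V E) (α β γ : R) (k : ℕ) :
    (G.transitionPolynomial α β γ).eval (k : R) =
      ∑ φ : G.KValuation k,
        (α + β + γ) ^ G.total φ * α ^ G.white φ * β ^ G.black φ * γ ^ G.cross φ := by
  classical
  rw [G.eval_transitionPolynomial_eq_sum_colourings]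
  -- A single vertex that violates the parity condition has local sum zero, which kills the product.
  have hzero (f : G.MedialEdge → Fin k)
      (hf : ¬ ∀ (e : E) (c : Fin k), Even (Nat.card {i : Fin 4 // f (G.medialEnd e i) = c})) :
      (∏ e : E, ∑ p : EmbeddedGraph.VertexState,
        if ∀ i, f (G.medialEnd e i) = f (G.medialEnd e (p.1 i))
          then G.vertexWeight α β γ e p else 0) = 0 := by
    obtain ⟨e, he⟩ := not_forall.1 hf
    refine Finset.prod_eq_zero (Finset.mem_univ e) ?_
    rw [EmbeddedGraph.even_fibres_iff fun i => f (G.medialEnd e i), not_or, not_or] at he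
    rw [EmbeddedGraph.sum_compatible_vertexWeight G α β γ e fun i => f (G.medialEnd e i),
      if_neg he.1, if_neg he.2.1, if_neg he.2.2, add_zero, add_zero]
  rw [← Finset.sum_filter_of_ne fun f _ hf => not_not.1 (mt (hzero f) hf),
    Finset.sum_subtype _ (p := fun f : G.MedialEdge → Fin k =>
      ∀ (e : E) (c : Fin k), Even (Nat.card {i : Fin 4 // f (G.medialEnd e i) = c}))
      (fun f => by simp)]
  refine Finset.sum_congr (by congr!) fun φ _ => ?_
  simp only [G.sum_compatible_vertexWeight_kValuation α β γ φ, Finset.prod_mul_distrib,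
    EmbeddedGraph.total, EmbeddedGraph.white, EmbeddedGraph.black, EmbeddedGraph.cross,
    EmbeddedGraph.pow_card_subtype]
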